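/- Consider randomized adaptive algorithms that know $n$ and $\varepsilon$ and have query access to an unknown function $f\colon\mathbb R^n\to\mathbb R$ and sample access to an unknown Borel probability distribution $\mathcal D$ on $\mathbb R^n$. For a property $\mathcal P$ (a set of functions $\mathbb R^n\to\mathbb R$) put $\delta_{\mathcal D}(f,\mathcal P)=\inf_{g\in\mathcal P}\Pr_{p\sim\mathcal D}[f(p)\neq g(p)]$. A distribution-free tester for $\mathcal P$ with proximity parameter $\varepsilon$ accepts every $f\in\mathcal P$ with probability at least $2/3$ and rejects every $f$ with $\delta_{\mathcal D}(f,\mathcal P)>\varepsilon$ with probability at least $2/3$, for every $\mathcal D$; it has one-sided error if it accepts every $f\in\mathcal P$ with probability $1$. Theorem. There are absolute constants $N,K,C$ such that for all $n$ and all $\varepsilon\in(0,1)$ the tester described below makes at most $C/\varepsilon$ queries to $f$, and it is 1. a one-sided error distribution-free tester, for (Borel) measurable $f\colon\mathbb R^n\to\mathbb R$, of additivity, i.e. of the property of being a measurable function with $g(x)+g(y)=g(x+y)$ for all $x,y$; 2. a one-sided error distribution-free tester, for continuous $f\colon\mathbb R^n\to\mathbb R$, of linearity, i.e. of the property $g(x)=\sum_{i=1}^n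 c_ix_i$ for some $c_1,\dots,c_n\in\mathbb R$. Tester. First, $N$ times: draw independent standard Gaussian vectors $x,y,z\sim\mathcal N(0,I)$ and reject if $f(-x)\ne -f(x)$, or $f(x-y)\neq f(x)-f(y)$, or $f\big(\tfrac{x-y}{\sqrt2}\big)\neq f\big(\tfrac{x-z}{\sqrt2}\big)+f\big(\tfrac{z-y}{\sqrt2}\big)$. Then, $\lceil K/\varepsilon\rceil$ times: draw $p\sim\mathcal D$ and a single Gaussian direction $x\sim\mathcal N(0,I)$, and reject if $f(p)\ne\kappa_p\big(f(p/\kappa_p-x)+f(x)\big)$, where $\kappa_p=1$ if $\|p\|_2\le 1/50$ and $\kappa_p=50\|p\|_2$ otherwise. If nothing was rejected, accept. -/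

import Mathlib

open MeasureTheory ProbabilityTheory
open scoped ENNReal

noncomputable section

/-- `ℝⁿ` with the Euclidean norm. -/
abbrev RealSpace (n : ℕ) : Type := EuclideanSpace ℝ (Fin n)

/-! ### Randomized adaptive algorithms with query access and sample access -/

/-- A randomized adaptive algorithm which has query access to an unknown function `f : ℝⁿ → ℝ`,
sample access to an unknown distribution `D` on `ℝⁿ`, can draw standard Gaussian vectors in `ℝⁿ`
as its internal randomness, and finally outputs an element of `α`. The next step may depend on all
the answers received so far (and on nothing else: neither on `f` nor on `D` directly). -/
inductive QueryAlg (n : ℕ) (α : Type) : Type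
  /-- stop and output `a` -/
  | output (a : α) : QueryAlg n α
  /-- query the function at the point `x` and continue with the answer -/
  | query (x : RealSpace n) (next : ℝ → QueryAlg n α) : QueryAlg n α
  /-- draw a fresh sample from the unknown distribution `D` -/
  | sample (next : RealSpace n → QueryAlg n α) : QueryAlg n α
  /-- draw a fresh standard Gaussian vector -/
  | gaussian (next : RealSpace n → QueryAlg n α) : QueryAlg n α

namespace QueryAlg

variable {n : ℕ} {α β : Type}

/-- Sequential composition: run the first algorithm, then continue with its output. -/
def andThen : QueryAlg n α → (α → QueryAlg n β) → QueryAlg n β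
  | output a, k => k a
  | query x next, k => query x fun y => andThen (next y) k
  | sample next, k => sample fun p => andThen (next p) k
  | gaussian next, k => gaussian fun x => andThen (next x) k

instance : Monad (QueryAlg n) where
  pure := output
  bind := andThen

/-- Ask for the value of the unknown function at `x`. -/
def ask (x : RealSpace n) : QueryAlg n ℝ := query x output

/-- A sample from the unknown distribution. -/
def drawSample : QueryAlg n (RealSpace n) := sample output

/-- A standard Gaussian vector `x ∼ N(0, I)`. -/
def drawGaussian : QueryAlg n (RealSpace n) := gaussian output

open Classical in
/-- The probability that the output is `b`, when queries are answered by `f`, samples are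
drawn (independently) from `D`, and the Gaussian vectors are drawn independently of everything. -/
def prob (f : RealSpace n → ℝ) (D : Measure (RealSpace n)) (b : α) : QueryAlg n α → ℝ≥0∞
  | output a => if a = b then 1 else 0
  | query x next => prob f D b (next (f x))
  | sample next => ∫⁻ p, prob f D b (next p) ∂D
  | gaussian next => ∫⁻ x, prob f D b (next x) ∂(stdGaussian (RealSpace n))

/-- The worst-case number of queries to the function (over all answers, samples and random
choices). -/
def queryComplexity : QueryAlg n α → ℕ∞
  | output _ => 0
  | query _ next => 1 + ⨆ y, queryComplexity (next y)
  | sample next => ⨆ p, queryComplexity (next p)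
  | gaussian next => ⨆ x, queryComplexity (next x)

end QueryAlg

/-! ### Properties, distance, and testers -/

/-- Additive (measurable) functions on `ℝⁿ`. -/
def additiveFunctions (n : ℕ) : Set (RealSpace n → ℝ) :=
  {g | Measurable g ∧ ∀ x y, g x + g y = g (x + y)}

/-- Linear functions on `ℝⁿ`. -/
def linearFunctions (n : ℕ) : Set (RealSpace n → ℝ) :=
  {g | ∃ c : Fin n → ℝ, ∀ x, g x = ∑ i, c i * x i}

/-- `δ_D(f, P) = inf_{g ∈ P} Pr_{x ∼ D}[f x ≠ g x]`. -/
def distToProperty {n : ℕ} (D : Measure (RealSpace n)) (f : RealSpace n → ℝ)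
    (P : Set (RealSpace n → ℝ)) : ℝ≥0∞ :=
  ⨅ g ∈ P, D {x | f x ≠ g x}

/-- `T` (with output `true` for "accept" and `false` for "reject") is a distribution-free tester
with proximity parameter `ε` for the property `P` of functions from the class `F`. -/
structure IsDistributionFreeTester {n : ℕ} (T : QueryAlg n Bool) (F P : Set (RealSpace n → ℝ))
    (ε : ℝ) : Prop where
  complete : ∀ (D : Measure (RealSpace n)) [IsProbabilityMeasure D], ∀ f ∈ F, f ∈ P →
    2 / 3 ≤ T.prob f D true
  sound : ∀ (D : Measure (RealSpace n)) [IsProbabilityMeasure D], ∀ f ∈ F,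
    ENNReal.ofReal ε < distToProperty D f P → 2 / 3 ≤ T.prob f D false

/-- The tester accepts every function (from the class `F`) with the property `P` with
probability one. -/
def HasOneSidedError {n : ℕ} (T : QueryAlg n Bool) (F P : Set (RealSpace n → ℝ)) : Prop :=
  ∀ (D : Measure (RealSpace n)) [IsProbabilityMeasure D], ∀ f ∈ F, f ∈ P → T.prob f D true = 1

/-! ### The tester that evaluates the self-corrected function with one Gaussian direction -/

section Algorithm

open QueryAlg

variable {n : ℕ}

/-- The radial contraction factor: `p / κ_p` lies in the ball of radius `1/50`. -/
def contractionFactor (p : RealSpace n) : ℝ :=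
  if ‖p‖ ≤ 1 / 50 then 1 else 50 * ‖p‖

/-- Evaluation of the self-corrected function at `p` with a single Gaussian direction `x`: the
output is `g_x(p) = κ_p (f(p / κ_p - x) + f(x))`. -/
def queryG (p : RealSpace n) : QueryAlg n ℝ := do
  let x ← drawGaussian
  let u ← ask ((contractionFactor p)⁻¹ • p - x)
  let v ← ask x
  return contractionFactor p * (u + v)

/-- Run `T` independently up to `k` times; reject as soon as one of the runs rejects. -/
def repeatTest (T : QueryAlg n Bool) : ℕ → QueryAlg n Bool
  | 0 => return true
  | k + 1 => do
    let b ← T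
    if b then repeatTest T k else return false

open Classical in
/-- One round of the additivity subroutine. -/
def additivityRound : QueryAlg n Bool := do
  let x ← drawGaussian
  let y ← drawGaussian
  let z ← drawGaussian
  let fnx ← ask (-x)
  let fx ← ask x
  if fnx ≠ -fx then return false else
    let fxy ← ask (x - y)
    let fy ← ask y
    if fxy ≠ fx - fy then return false else
      let a ← ask ((√2)⁻¹ • (x - y))
      let b ← ask ((√2)⁻¹ • (x - z))
      let c ← ask ((√2)⁻¹ • (z - y))
      if a ≠ b + c then return false else return true

open Classical in
/-- One comparison of `f` with its self-correction at a random point `p ∼ D`. -/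
def correctionRound : QueryAlg n Bool := do
  let p ← drawSample
  let w ← ask p
  let v ← queryG p
  if w ≠ v then return false else return true

/-- The tester: `N` rounds of the additivity subroutine, followed by `M` comparisons of `f` with
its self-correction. -/
def singleDirectionTester (n N M : ℕ) : QueryAlg n Bool := do
  let b ← repeatTest additivityRound N
  if b then repeatTest correctionRound M else return false

end Algorithm

end

/-!
A translation of the standard Gaussian by `p` moves it by at most `‖p‖` in total variation: along
`p` this is a one-dimensional density estimate, and the orthogonal directions are unaffected.

If `f (x - y) = f x - f y` for most pairs of Gaussian vectors, then for short `p` the random values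
`f (p - x) + f x` and `f (p - y) + f y` agree with high probability, so some value `h p` is attained
for most `x`. The rotated identity lets one compute `h (p + q)`, `h p` and `h q` along the three
correlated standard Gaussian directions `(x - y) / √2`, `(x - z) / √2`, `(z - y) / √2`; since the
first is the sum of the other two, `h` is additive near `0`. It is also bounded there, because `f`
is bounded off a set of small Gaussian measure, so it is the restriction of a linear map `L`. If `f`
is `ε`-far from `L`, then a sample `p` has `f p ≠ L p` with probability more than `ε`, and the
comparison round at such a `p` rejects for all but few Gaussian directions.
-/

noncomputable section

open scoped NNReal

/-- `φ` maps `μ` to a measure which exceeds `ν` by at most `δ` on every measurable set. Between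
probability measures this says that `φ_* μ` and `ν` are at total variation distance at most `δ`. -/
structure AlmostMeasurePreserving {X Y : Type*} [MeasurableSpace X] [MeasurableSpace Y]
    (φ : X → Y) (μ : Measure X) (ν : Measure Y) (δ : ℝ≥0) : Prop where
  measurable : Measurable φ
  measure_preimage_le : ∀ A, MeasurableSet A → μ (φ ⁻¹' A) ≤ ν A + δ

namespace AlmostMeasurePreserving

variable {X Y Z W : Type*} [MeasurableSpace X] [MeasurableSpace Y] [MeasurableSpace Z]
  [MeasurableSpace W] {μ : Measure X} {ν : Measure Y} {ρ : Measure Z} {δ δ' : ℝ≥0}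

lemma of_measurePreserving {φ : X → Y} (h : MeasurePreserving φ μ ν) :
    AlmostMeasurePreserving φ μ ν 0 where
  measurable := h.measurable
  measure_preimage_le A hA := by simp [h.measure_preimage hA.nullMeasurableSet]

lemma comp {φ : X → Y} {ψ : Y → Z} (hψ : AlmostMeasurePreserving ψ ν ρ δ')
    (hφ : AlmostMeasurePreserving φ μ ν δ) : AlmostMeasurePreserving (ψ ∘ φ) μ ρ (δ' + δ) where
  measurable := hψ.measurable.comp hφ.measurable
  measure_preimage_le A hA := calc
    μ (φ ⁻¹' (ψ ⁻¹' A)) ≤ ν (ψ ⁻¹' A) + δ := hφ.measure_preimage_le _ (hψ.measurable hA)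
    _ ≤ ρ A + δ' + δ := by gcongr; exact hψ.measure_preimage_le A hA
    _ = ρ A + ↑(δ' + δ) := by rw [add_assoc, ENNReal.coe_add]

lemma prod_left [IsProbabilityMeasure ρ] [SFinite μ] [SFinite ν] {φ : X → Y}
    (hφ : AlmostMeasurePreserving φ μ ν δ) :
    AlmostMeasurePreserving (Prod.map φ (id : Z → Z)) (μ.prod ρ) (ν.prod ρ) δ where
  measurable := hφ.measurable.prodMap measurable_id
  measure_preimage_le A hA := calc
    (μ.prod ρ) (Prod.map φ id ⁻¹' A)
      = ∫⁻ z, μ (φ ⁻¹' ((fun y => (y, z)) ⁻¹' A)) ∂ρ :=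
        Measure.prod_apply_symm (hφ.measurable.prodMap measurable_id hA)
    _ ≤ ∫⁻ z, (ν ((fun y => (y, z)) ⁻¹' A) + δ) ∂ρ :=
        lintegral_mono fun z => hφ.measure_preimage_le _ (measurable_prodMk_right hA)
    _ = (ν.prod ρ) A + δ := by
        rw [lintegral_add_right _ measurable_const, ← Measure.prod_apply_symm hA]; simp

lemma prod [IsProbabilityMeasure μ] [SFinite ν] {κ : Measure W} [SFinite ρ]
    [IsProbabilityMeasure κ] {φ : X → Y} {ψ : Z → W}
    (hφ : AlmostMeasurePreserving φ μ ν δ) (hψ : AlmostMeasurePreserving ψ ρ κ δ') :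
    AlmostMeasurePreserving (Prod.map φ ψ) (μ.prod ρ) (ν.prod κ) (δ + δ') := by
  have hψ_swap : AlmostMeasurePreserving (Prod.map id ψ) (μ.prod ρ) (μ.prod κ) δ' := by
    have h := (of_measurePreserving Measure.measurePreserving_swap).comp
      ((hψ.prod_left (ρ := μ)).comp (of_measurePreserving Measure.measurePreserving_swap))
    rwa [add_zero, zero_add] at h
  exact (hφ.prod_left (ρ := κ)).comp hψ_swap

lemma of_semiconj {φ : X → Y} {T : X → X} {S : Y → Y} (hT : AlmostMeasurePreserving T μ μ δ)
    (hφ : MeasurePreserving φ μ ν) (h : Function.Semiconj φ T S) (hS : Measurable S) :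
    AlmostMeasurePreserving S ν ν δ where
  measurable := hS
  measure_preimage_le A hA := calc
    ν (S ⁻¹' A) = μ (T ⁻¹' (φ ⁻¹' A)) := by
        rw [← hφ.measure_preimage (hS hA).nullMeasurableSet, ← Set.preimage_comp,
          ← Set.preimage_comp, h.comp_eq]
    _ ≤ μ (φ ⁻¹' A) + δ := hT.measure_preimage_le _ (hφ.measurable hA)
    _ = ν A + δ := by rw [hφ.measure_preimage hA.nullMeasurableSet]

lemma measureReal_preimage_le [IsFiniteMeasure ν] {φ : X → Y}
    (hφ : AlmostMeasurePreserving φ μ ν δ) {A : Set Y} (hA : MeasurableSet A) :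
    μ.real (φ ⁻¹' A) ≤ ν.real A + δ := by
  refine (ENNReal.toReal_mono (by finiteness) (hφ.measure_preimage_le A hA)).trans_eq ?_
  rw [ENNReal.toReal_add (by finiteness) (by finiteness), ENNReal.coe_toReal, Measure.real]

end AlmostMeasurePreserving

lemma gaussianPDFReal_zero_one_le_iff {c : ℝ} (hc : 0 < c) (x : ℝ) :
    gaussianPDFReal 0 1 x ≤ gaussianPDFReal c 1 x ↔ c / 2 ≤ x := by
  have hpos : 0 < (√(2 * Real.pi * (1 : ℝ≥0)))⁻¹ := by
    rw [NNReal.coe_one]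
    positivity
  rw [gaussianPDFReal, gaussianPDFReal, mul_le_mul_iff_right₀ hpos, Real.exp_le_exp,
    div_le_div_iff_of_pos_right (by norm_num), neg_le_neg_iff]
  constructor <;> intro h <;> nlinarith

lemma gaussianPDFReal_zero_one_le_one (x : ℝ) : gaussianPDFReal 0 1 x ≤ 1 := by
  have hsqrt : 1 ≤ √(2 * Real.pi * (1 : ℝ≥0)) := by
    rw [Real.one_le_sqrt, NNReal.coe_one]; linarith [Real.two_le_pi]
  have hexp : Real.exp (-(x - 0) ^ 2 / (2 * (1 : ℝ≥0))) ≤ 1 := by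
    rw [Real.exp_le_one_iff, neg_div]
    exact neg_nonpos.2 (by positivity)
  exact mul_le_one₀ (inv_le_one_of_one_le₀ hsqrt) (Real.exp_nonneg _) hexp

lemma integral_Ici_gaussianPDFReal_sub_le {c : ℝ} (hc : 0 ≤ c) :
    ∫ x in Set.Ici (c / 2), (gaussianPDFReal c 1 x - gaussianPDFReal 0 1 x) ≤ c := by
  have hint (m : ℝ) (s : Set ℝ) : IntegrableOn (gaussianPDFReal m 1) s :=
    (integrable_gaussianPDFReal m 1).integrableOn
  have hshift : ∫ x in Set.Ici (c / 2), gaussianPDFReal c 1 x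
      = ∫ x in Set.Ici (-(c / 2)), gaussianPDFReal 0 1 x := by
    have h := (measurePreserving_sub_right volume c).setIntegral_preimage_emb
      (measurableEmbedding_subRight c) (gaussianPDFReal 0 1) (Set.Ici (-(c / 2)))
    simpa only [Set.preimage_sub_const_Ici, gaussianPDFReal_sub, zero_add, neg_add_eq_sub,
      sub_half] using h
  have hdisj : Disjoint (Set.Ico (-(c / 2)) (c / 2)) (Set.Ici (c / 2)) :=
    (Set.Iio_disjoint_Ici le_rfl).mono_left Set.Ico_subset_Iio_self
  have hsplit : Set.Ici (-(c / 2)) = Set.Ico (-(c / 2)) (c / 2) ∪ Set.Ici (c / 2) :=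
    (Set.Ico_union_Ici_eq_Ici (by linarith)).symm
  rw [integral_sub (hint _ _) (hint _ _), hshift, hsplit,
    setIntegral_union hdisj measurableSet_Ici (hint _ _) (hint _ _), add_sub_cancel_right]
  calc ∫ x in Set.Ico (-(c / 2)) (c / 2), gaussianPDFReal 0 1 x
      ≤ ∫ x in Set.Ico (-(c / 2)) (c / 2), 1 :=
        setIntegral_mono (hint _ _) (by simp) gaussianPDFReal_zero_one_le_one
    _ = c := by simp [hc]

lemma almostMeasurePreserving_add_const_gaussianReal (c : ℝ≥0) :
    AlmostMeasurePreserving (· + (c : ℝ)) (gaussianReal 0 1) (gaussianReal 0 1) c where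
  measurable := measurable_add_const _
  measure_preimage_le A hA := by
    rcases eq_zero_or_pos c with rfl | hc
    · simp
    have hint (m : ℝ) : Integrable (gaussianPDFReal m 1) := integrable_gaussianPDFReal m 1
    have hsub : (∫ x in A, gaussianPDFReal c 1 x) - ∫ x in A, gaussianPDFReal 0 1 x ≤ c := calc
      _ = ∫ x in A, (gaussianPDFReal c 1 x - gaussianPDFReal 0 1 x) :=
        (integral_sub (hint _).integrableOn (hint _).integrableOn).symm
      _ ≤ ∫ x in {x | 0 ≤ gaussianPDFReal c 1 x - gaussianPDFReal 0 1 x},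
            (gaussianPDFReal c 1 x - gaussianPDFReal 0 1 x) :=
        setIntegral_le_nonneg hA (by fun_prop) ((hint _).sub (hint _))
      _ = ∫ x in Set.Ici (c / 2 : ℝ), (gaussianPDFReal c 1 x - gaussianPDFReal 0 1 x) := by
        simp only [sub_nonneg, gaussianPDFReal_zero_one_le_iff (NNReal.coe_pos.2 hc), Set.Ici]
      _ ≤ c := integral_Ici_gaussianPDFReal_sub_le c.2
    rw [← Measure.map_apply (measurable_add_const _) hA, gaussianReal_map_add_const, zero_add,
      gaussianReal_apply_eq_integral _ one_ne_zero, gaussianReal_apply_eq_integral _ one_ne_zero,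
      ← ENNReal.ofReal_coe_nnreal, ← ENNReal.ofReal_add ?_ c.coe_nonneg]
    · exact ENNReal.ofReal_le_ofReal (sub_le_iff_le_add'.1 hsub)
    · exact integral_nonneg fun _ => gaussianPDFReal_nonneg _ _ _

section StdGaussian

variable {E : Type*} [NormedAddCommGroup E] [InnerProductSpace ℝ E] [FiniteDimensional ℝ E]
  [MeasurableSpace E] [BorelSpace E]

lemma gaussianReal_zero_one_eq_stdGaussian : gaussianReal 0 1 = stdGaussian ℝ := by
  apply Measure.ext_of_charFun
  ext t
  simp [charFun_gaussianReal, charFun_stdGaussian, ← Complex.ofReal_pow, neg_div]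

lemma measurePreserving_coprod_stdGaussian {F G : Type*}
    [NormedAddCommGroup F] [InnerProductSpace ℝ F] [FiniteDimensional ℝ F]
    [MeasurableSpace F] [BorelSpace F]
    [NormedAddCommGroup G] [InnerProductSpace ℝ G] [FiniteDimensional ℝ G]
    [MeasurableSpace G] [BorelSpace G] (L₁ : F →L[ℝ] E) (L₂ : G →L[ℝ] E)
    (hL : ∀ t : StrongDual ℝ E, ‖t ∘L L₁‖ ^ 2 + ‖t ∘L L₂‖ ^ 2 = ‖t‖ ^ 2) :
    MeasurePreserving (L₁.coprod L₂) ((stdGaussian F).prod (stdGaussian G)) (stdGaussian E) where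
  measurable := (L₁.coprod L₂).measurable
  map_eq := by
    have := Measure.isProbabilityMeasure_map (μ := (stdGaussian F).prod (stdGaussian G))
      (L₁.coprod L₂).measurable.aemeasurable
    apply Measure.ext_of_charFunDual
    ext t
    rw [charFunDual_map, charFunDual_prod, charFunDual_stdGaussian, charFunDual_stdGaussian,
      charFunDual_stdGaussian, ContinuousLinearMap.comp_assoc, ContinuousLinearMap.comp_assoc,
      ContinuousLinearMap.coprod_comp_inl, ContinuousLinearMap.coprod_comp_inr, ← Complex.exp_add,
      ← Complex.ofReal_pow ‖t‖, ← hL t]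
    push_cast
    ring_nf

lemma measurePreserving_inv_sqrt_two_smul_sub :
    MeasurePreserving (fun w : E × E => (√2)⁻¹ • (w.1 - w.2))
      ((stdGaussian E).prod (stdGaussian E)) (stdGaussian E) := by
  have h := measurePreserving_coprod_stdGaussian ((√2)⁻¹ • .id ℝ E) (-((√2)⁻¹ • .id ℝ E))
    fun t => by
      rw [ContinuousLinearMap.comp_neg, norm_neg, ContinuousLinearMap.comp_smul,
        ContinuousLinearMap.comp_id, norm_smul, Real.norm_eq_abs, mul_pow, sq_abs, inv_pow,
        Real.sq_sqrt two_pos.le]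
      ring
  convert h using 2 with w
  simp [sub_eq_add_neg]

lemma measurePreserving_resample_stdGaussian {e : E} (he : ‖e‖ = 1) :
    MeasurePreserving (fun w : ℝ × E => w.1 • e + (w.2 - inner ℝ e w.2 • e))
      ((gaussianReal 0 1).prod (stdGaussian E)) (stdGaussian E) := by
  rw [gaussianReal_zero_one_eq_stdGaussian]
  refine measurePreserving_coprod_stdGaussian (.toSpanSingleton ℝ e)
    (.id ℝ E - (innerSL ℝ e).smulRight e) fun t => ?_
  obtain ⟨v, rfl⟩ := (InnerProductSpace.toDual ℝ E).surjective t
  have hline : InnerProductSpace.toDual ℝ E v ∘L .toSpanSingleton ℝ e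
      = InnerProductSpace.toDual ℝ ℝ (inner ℝ v e) := by
    ext
    simp
  have horth : InnerProductSpace.toDual ℝ E v ∘L (.id ℝ E - (innerSL ℝ e).smulRight e)
      = InnerProductSpace.toDual ℝ E (v - inner ℝ v e • e) := by
    ext x
    simp [mul_comm]
  rw [hline, horth]
  simp only [LinearIsometryEquiv.norm_map]
  rw [norm_sub_sq_real, norm_smul, inner_smul_right, he, Real.norm_eq_abs, mul_one, sq_abs]
  ring

lemma almostMeasurePreserving_add_right_stdGaussian (p : E) :
    AlmostMeasurePreserving (· + p) (stdGaussian E) (stdGaussian E) ‖p‖₊ := by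
  rcases eq_or_ne p 0 with rfl | hp
  · simpa [Function.id_def] using
      AlmostMeasurePreserving.of_measurePreserving (.id (stdGaussian E))
  have he : ‖‖p‖⁻¹ • p‖ = 1 := norm_smul_inv_norm hp
  have hT := (almostMeasurePreserving_add_const_gaussianReal ‖p‖₊).prod_left (ρ := stdGaussian E)
  refine hT.of_semiconj (measurePreserving_resample_stdGaussian he) (fun w => ?_)
    (measurable_add_const p)
  have hpe : ‖p‖ • ‖p‖⁻¹ • p = p := smul_inv_smul₀ (norm_ne_zero_iff.2 hp) p
  simp only [Prod.map_fst, Prod.map_snd, id, coe_nnnorm, add_smul, hpe]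
  abel

lemma almostMeasurePreserving_sub_left_stdGaussian (p : E) :
    AlmostMeasurePreserving (p - ·) (stdGaussian E) (stdGaussian E) ‖p‖₊ := by
  have hneg : MeasurePreserving (fun x : E => -x) (stdGaussian E) (stdGaussian E) :=
    ⟨measurable_neg, stdGaussian_map (LinearIsometryEquiv.neg ℝ)⟩
  have h := (almostMeasurePreserving_add_right_stdGaussian p).comp (.of_measurePreserving hneg)
  simpa [Function.comp_def, neg_add_eq_sub] using h

end StdGaussian

open Filter Topology

section LocalAdditivity

variable {E F : Type*} [NormedAddCommGroup E] [NormedSpace ℝ E]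

lemma two_pow_nsmul_map_inv_two_pow_smul [AddCommGroup F] {h : E → F} {r : ℝ}
    (hadd : ∀ p q, ‖p‖ ≤ r → ‖q‖ ≤ r → ‖p + q‖ ≤ r → h (p + q) = h p + h q) (k : ℕ) {p : E}
    (hp : ‖p‖ ≤ r) : 2 ^ k • h ((2⁻¹ : ℝ) ^ k • p) = h p := by
  induction k generalizing p with
  | zero => simp
  | succ k ih =>
    have hhalf : (2⁻¹ : ℝ) • p + (2⁻¹ : ℝ) • p = p := by
      rw [← two_smul ℝ, smul_inv_smul₀ two_ne_zero]
    have hhalf_norm : ‖(2⁻¹ : ℝ) • p‖ ≤ r := by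
      rw [norm_smul]
      exact (mul_le_of_le_one_left (norm_nonneg p) (by norm_num)).trans hp
    rw [pow_succ', pow_succ, mul_smul, mul_smul, ih hhalf_norm, two_nsmul,
      ← hadd _ _ hhalf_norm hhalf_norm (hhalf.symm ▸ hp), hhalf]

lemma exists_addMonoidHom_eqOn_closedBall [AddCommGroup F] {h : E → F} {r : ℝ} (hr : 0 < r)
    (hadd : ∀ p q, ‖p‖ ≤ r → ‖q‖ ≤ r → ‖p + q‖ ≤ r → h (p + q) = h p + h q) :
    ∃ G : E →+ F, ∀ p, ‖p‖ ≤ r → h p = G p := by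
  have hball (p : E) : ∀ᶠ k in atTop, ‖(2⁻¹ : ℝ) ^ k • p‖ ≤ r := by
    have hlim : Tendsto (fun k => ‖(2⁻¹ : ℝ) ^ k • p‖) atTop (𝓝 0) := by
      simpa using ((tendsto_pow_atTop_nhds_zero_of_lt_one (by norm_num : (0 : ℝ) ≤ 2⁻¹)
        (by norm_num)).smul_const p).norm
    exact hlim.eventually_le_const hr
  have hconst (p : E) : ∃ v, ∀ᶠ k in atTop, 2 ^ k • h ((2⁻¹ : ℝ) ^ k • p) = v := by
    obtain ⟨m, hm⟩ := (hball p).exists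
    refine ⟨2 ^ m • h ((2⁻¹ : ℝ) ^ m • p), (eventually_ge_atTop m).mono fun k hmk => ?_⟩
    obtain ⟨j, rfl⟩ := Nat.exists_eq_add_of_le hmk
    rw [← two_pow_nsmul_map_inv_two_pow_smul hadd j hm, smul_smul, smul_smul, ← pow_add,
      ← pow_add, add_comm j m]
  choose G hG using hconst
  refine ⟨AddMonoidHom.mk' G fun p q => ?_, fun p hp => ?_⟩
  · obtain ⟨k, hGp, hGq, hGpq, hp, hq, hpq⟩ := ((hG p).and <| (hG q).and <| (hG (p + q)).and <|
      (hball p).and <| (hball q).and (hball (p + q))).exists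
    rw [smul_add] at hpq hGpq
    rw [← hGp, ← hGq, ← hGpq, hadd _ _ hp hq hpq, smul_add]
  · obtain ⟨k, hGk⟩ := (hG p).exists
    rw [AddMonoidHom.mk'_apply, ← hGk, two_pow_nsmul_map_inv_two_pow_smul hadd k hp]

lemma exists_continuousLinearMap_eqOn_closedBall [NormedAddCommGroup F] [NormedSpace ℝ F]
    {h : E → F} {r M : ℝ} (hr : 0 < r)
    (hadd : ∀ p q, ‖p‖ ≤ r → ‖q‖ ≤ r → ‖p + q‖ ≤ r → h (p + q) = h p + h q)
    (hM : ∀ p, ‖p‖ ≤ r → ‖h p‖ ≤ M) :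
    ∃ L : E →L[ℝ] F, ∀ p, ‖p‖ ≤ r → h p = L p := by
  obtain ⟨G, hG⟩ := exists_addMonoidHom_eqOn_closedBall hr hadd
  have hbdd : Bornology.IsBounded (G '' Metric.closedBall 0 r) := by
    rw [isBounded_iff_forall_norm_le]
    refine ⟨M, ?_⟩
    rintro _ ⟨p, hp, rfl⟩
    rw [mem_closedBall_zero_iff] at hp
    exact hG p hp ▸ hM p hp
  have hcont := G.continuous_of_isBounded_nhds_zero (Metric.closedBall_mem_nhds 0 hr) hbdd
  exact ⟨G.toRealLinearMap hcont, hG⟩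

end LocalAdditivity

lemma inv_sqrt_two_smul_sub_sub {V : Type*} [AddCommGroup V] [Module ℝ V] (p q x y : V) :
    (√2)⁻¹ • (√2 • p - x - (√2 • q - y)) = p - q - (√2)⁻¹ • (x - y) := by
  rw [sub_sub_sub_comm, ← smul_sub √2, smul_sub (√2)⁻¹, inv_smul_smul₀ (by positivity)]

lemma exists_forall_notMem_of_sum_measureReal_lt_one {X : Type*} [MeasurableSpace X]
    {μ : Measure X} [IsProbabilityMeasure μ] {l : List (Set X)} (hl : (l.map μ.real).sum < 1) :
    ∃ x, ∀ s ∈ l, x ∉ s := by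
  have hunion (l : List (Set X)) : μ.real {x | ∃ s ∈ l, x ∈ s} ≤ (l.map μ.real).sum := by
    induction l with
    | nil => simp
    | cons s l ih =>
      simp only [List.exists_mem_cons_iff, List.map_cons, List.sum_cons]
      exact (measureReal_union_le s _).trans (add_le_add le_rfl ih)
  by_contra! h
  have := hunion l
  rw [Set.eq_univ_of_forall (s := {x | ∃ s ∈ l, x ∈ s}) h, probReal_univ] at this
  linarith

lemma exists_measureReal_lt_norm_le {X F : Type*} [MeasurableSpace X] [NormedAddCommGroup F]
    [MeasurableSpace F] [OpensMeasurableSpace F] (μ : Measure X) [IsFiniteMeasure μ] {g : X → F}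
    (hg : Measurable g) {δ : ℝ} (hδ : 0 < δ) :
    ∃ R, μ.real {x | R < ‖g x‖} ≤ δ := by
  have hm (k : ℕ) : MeasurableSet {x | (k : ℝ) < ‖g x‖} :=
    measurableSet_lt measurable_const hg.norm
  have hanti : Antitone fun k : ℕ => {x | (k : ℝ) < ‖g x‖} :=
    fun i j hij x (hx : (j : ℝ) < ‖g x‖) => (Nat.cast_le.2 hij).trans_lt hx
  have hempty : ⋂ k : ℕ, {x | (k : ℝ) < ‖g x‖} = ∅ :=
    Set.eq_empty_of_forall_notMem fun x hx =>
      (exists_nat_ge ‖g x‖).elim fun k hk => not_lt_of_ge hk (Set.mem_iInter.1 hx k)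
  have hlim := tendsto_measure_iInter_atTop (μ := μ) (fun k => (hm k).nullMeasurableSet) hanti
    ⟨0, measure_ne_top _ _⟩
  rw [hempty, measure_empty] at hlim
  obtain ⟨k, hk⟩ := (hlim.eventually_le_const (ENNReal.ofReal_pos.2 hδ)).exists
  exact ⟨k, ENNReal.toReal_le_of_le_ofReal hδ.le hk⟩

section SelfCorrection

variable {E F : Type*} [NormedAddCommGroup E] [InnerProductSpace ℝ E] [FiniteDimensional ℝ E]
  [MeasurableSpace E] [BorelSpace E] [NormedAddCommGroup F]

/-- The probability that `f (p - x) + f x`, for a standard Gaussian direction `x`, is not `c`. -/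
def selfCorrectionError (f : E → F) (p : E) (c : F) : ℝ :=
  (stdGaussian E).real {x | f (p - x) + f x ≠ c}

/-- The probability that `f (x - y) = f x - f y` fails for independent standard Gaussian vectors
`x = w.1`, `y = w.2`. -/
def differenceError (f : E → F) : ℝ :=
  ((stdGaussian E).prod (stdGaussian E)).real {w | f (w.1 - w.2) ≠ f w.1 - f w.2}

/-- The probability that the third check of the additivity subroutine fails for independent
standard Gaussian vectors `x = w.1`, `y = w.2.1`, `z = w.2.2`. -/
def rotatedDifferenceError (f : E → F) : ℝ :=
  ((stdGaussian E).prod ((stdGaussian E).prod (stdGaussian E))).real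
    {w | f ((√2)⁻¹ • (w.1 - w.2.1)) ≠ f ((√2)⁻¹ • (w.1 - w.2.2)) + f ((√2)⁻¹ • (w.2.2 - w.2.1))}

variable [MeasurableSpace F] [BorelSpace F] {f : E → F}

lemma exists_norm_le_of_selfCorrectionError_le (hf : Measurable f) :
    ∃ M, ∀ (p : E) (c : F), selfCorrectionError f p c + ‖p‖ ≤ 1 / 2 → ‖c‖ ≤ M := by
  obtain ⟨R, hR⟩ := exists_measureReal_lt_norm_le (stdGaussian E) hf (δ := 1 / 5) (by norm_num)
  refine ⟨R + R, fun p c hc => ?_⟩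
  have hshift := (almostMeasurePreserving_sub_left_stdGaussian p).measureReal_preimage_le
    (measurableSet_lt (measurable_const (a := R)) hf.norm)
  obtain ⟨x, hx⟩ := exists_forall_notMem_of_sum_measureReal_lt_one (μ := stdGaussian E)
    (l := [{x | f (p - x) + f x ≠ c}, {x | R < ‖f x‖}, (p - ·) ⁻¹' {x | R < ‖f x‖}]) (by
    simp only [List.map_cons, List.map_nil, List.sum_cons, List.sum_nil]
    rw [selfCorrectionError] at hc
    rw [coe_nnnorm] at hshift
    linarith)
  simp only [List.forall_mem_cons, Set.mem_preimage, Set.mem_ofPred_eq, not_not, not_lt] at hx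
  obtain ⟨hsum, hx, hpx, -⟩ := hx
  exact hsum ▸ norm_add_le_of_le hpx hx

variable [SecondCountableTopology F]

lemma exists_selfCorrectionError_le (hf : Measurable f) (p : E) :
    ∃ c, selfCorrectionError f p c ≤ 2 * differenceError f + 2 * ‖p‖ := by
  set γ := stdGaussian E
  set S : Set (E × E) := {w | f (p - w.1) + f w.1 ≠ f (p - w.2) + f w.2}
  set B : Set (E × E) := {w | f (w.1 - w.2) ≠ f w.1 - f w.2}
  have hS : MeasurableSet S := (measurableSet_eq_fun (by fun_prop) (by fun_prop)).compl
  have hB : MeasurableSet B := (measurableSet_eq_fun (by fun_prop) (by fun_prop)).compl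
  have hsub : S ⊆ Prod.map (p - ·) (p - ·) ⁻¹' B ∪ Prod.swap ⁻¹' B := by
    rintro ⟨x, y⟩ hw
    by_contra hcon
    simp only [B, Set.mem_union, Set.mem_preimage, Prod.map_apply, Prod.swap_prod_mk,
      Set.mem_ofPred_eq, sub_sub_sub_cancel_left, not_or, not_not] at hcon
    obtain ⟨hxy, hyx⟩ := hcon
    have hxy_eq := sub_eq_sub_iff_add_eq_add.1 (hxy.symm.trans hyx)
    exact hw (hxy_eq.trans (add_comm _ _))
  have hshift := (almostMeasurePreserving_sub_left_stdGaussian p).prod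
    (almostMeasurePreserving_sub_left_stdGaussian p)
  have hSle : (γ.prod γ).real S ≤ 2 * differenceError f + 2 * ‖p‖ := calc
    (γ.prod γ).real S
      ≤ (γ.prod γ).real (Prod.map (p - ·) (p - ·) ⁻¹' B) + (γ.prod γ).real (Prod.swap ⁻¹' B) :=
        (measureReal_mono hsub).trans (measureReal_union_le _ _)
    _ ≤ ((γ.prod γ).real B + (‖p‖₊ + ‖p‖₊ : ℝ≥0)) + (γ.prod γ).real B :=
        add_le_add (hshift.measureReal_preimage_le hB)
          (Measure.measurePreserving_swap.measureReal_preimage hB.nullMeasurableSet).le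
    _ = 2 * differenceError f + 2 * ‖p‖ := by
        simp only [differenceError, γ, B, NNReal.coe_add, coe_nnnorm]
        ring
  obtain ⟨y, hy⟩ := exists_le_lintegral (μ := γ)
    (measurable_measure_prodMk_right (μ := γ) hS).aemeasurable
  rw [← Measure.prod_apply_symm hS] at hy
  exact ⟨f (p - y) + f y, (ENNReal.toReal_mono (by finiteness) hy).trans hSle⟩

lemma measurePreserving_inv_sqrt_two_smul_sub_fst_mid :
    MeasurePreserving (fun w : E × E × E => (√2)⁻¹ • (w.1 - w.2.1))
      ((stdGaussian E).prod ((stdGaussian E).prod (stdGaussian E))) (stdGaussian E) :=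
  measurePreserving_inv_sqrt_two_smul_sub.comp ((MeasurePreserving.id _).prod measurePreserving_fst)

lemma measurePreserving_inv_sqrt_two_smul_sub_fst_last :
    MeasurePreserving (fun w : E × E × E => (√2)⁻¹ • (w.1 - w.2.2))
      ((stdGaussian E).prod ((stdGaussian E).prod (stdGaussian E))) (stdGaussian E) :=
  measurePreserving_inv_sqrt_two_smul_sub.comp ((MeasurePreserving.id _).prod measurePreserving_snd)

lemma measurePreserving_inv_sqrt_two_smul_sub_last_mid :
    MeasurePreserving (fun w : E × E × E => (√2)⁻¹ • (w.2.2 - w.2.1))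
      ((stdGaussian E).prod ((stdGaussian E).prod (stdGaussian E))) (stdGaussian E) :=
  measurePreserving_inv_sqrt_two_smul_sub.comp
    (Measure.measurePreserving_swap.comp measurePreserving_snd)

lemma measureReal_shifted_rotatedDifference_le (hf : Measurable f) (p q : E) :
    ((stdGaussian E).prod ((stdGaussian E).prod (stdGaussian E))).real
      {w | f (p + q - (√2)⁻¹ • (w.1 - w.2.1)) ≠
        f (p - (√2)⁻¹ • (w.1 - w.2.2)) + f (q - (√2)⁻¹ • (w.2.2 - w.2.1))}
      ≤ rotatedDifferenceError f + √2 * (‖p‖ + ‖q‖) := by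
  have hC : MeasurableSet {w : E × E × E | f ((√2)⁻¹ • (w.1 - w.2.1)) ≠
      f ((√2)⁻¹ • (w.1 - w.2.2)) + f ((√2)⁻¹ • (w.2.2 - w.2.1))} :=
    (measurableSet_eq_fun (by fun_prop) (by fun_prop)).compl
  have h := ((almostMeasurePreserving_sub_left_stdGaussian (√2 • p)).prod
    ((almostMeasurePreserving_sub_left_stdGaussian (√2 • -q)).prod
      (almostMeasurePreserving_sub_left_stdGaussian (√2 • (0 : E))))).measureReal_preimage_le hC
  simp only [Set.preimage_ofPred_eq, Prod.map_fst, Prod.map_snd, inv_sqrt_two_smul_sub_sub,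
    sub_zero, zero_add, sub_neg_eq_add] at h
  refine h.trans_eq ?_
  simp only [rotatedDifferenceError, NNReal.coe_add, coe_nnnorm, norm_neg, norm_smul,
    Real.norm_of_nonneg (Real.sqrt_nonneg 2), norm_zero]
  ring

lemma eq_add_of_selfCorrectionError_lt (hf : Measurable f) {p q : E} {a b c : F}
    (h : selfCorrectionError f p a + selfCorrectionError f q b + selfCorrectionError f (p + q) c
      + 2 * rotatedDifferenceError f + √2 * (‖p‖ + ‖q‖) < 1) : c = a + b := by
  set μ := (stdGaussian E).prod ((stdGaussian E).prod (stdGaussian E))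
  have hpull (v : E) (d : F) {φ : E × E × E → E} (hφ : MeasurePreserving φ μ (stdGaussian E)) :
      μ.real {w | f (v - φ w) + f (φ w) ≠ d} = selfCorrectionError f v d := by
    have hm : MeasurableSet {x | f (v - x) + f x = d} :=
      measurableSet_eq_fun (by fun_prop) (by fun_prop)
    exact hφ.measureReal_preimage hm.compl.nullMeasurableSet
  have hp := hpull p a measurePreserving_inv_sqrt_two_smul_sub_fst_last
  have hq := hpull q b measurePreserving_inv_sqrt_two_smul_sub_last_mid
  have hpq := hpull (p + q) c measurePreserving_inv_sqrt_two_smul_sub_fst_mid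
  have hshift := measureReal_shifted_rotatedDifference_le hf p q
  obtain ⟨w, hw⟩ := exists_forall_notMem_of_sum_measureReal_lt_one (μ := μ)
    (l := [{w | f (p - (√2)⁻¹ • (w.1 - w.2.2)) + f ((√2)⁻¹ • (w.1 - w.2.2)) ≠ a},
      {w | f (q - (√2)⁻¹ • (w.2.2 - w.2.1)) + f ((√2)⁻¹ • (w.2.2 - w.2.1)) ≠ b},
      {w | f (p + q - (√2)⁻¹ • (w.1 - w.2.1)) + f ((√2)⁻¹ • (w.1 - w.2.1)) ≠ c},
      {w | f ((√2)⁻¹ • (w.1 - w.2.1)) ≠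
        f ((√2)⁻¹ • (w.1 - w.2.2)) + f ((√2)⁻¹ • (w.2.2 - w.2.1))},
      {w | f (p + q - (√2)⁻¹ • (w.1 - w.2.1)) ≠
        f (p - (√2)⁻¹ • (w.1 - w.2.2)) + f (q - (√2)⁻¹ • (w.2.2 - w.2.1))}]) (by
    simp only [List.map_cons, List.map_nil, List.sum_cons, List.sum_nil]
    rw [hp, hq, hpq]
    rw [rotatedDifferenceError] at h hshift
    linarith)
  simp only [List.forall_mem_cons, Set.mem_ofPred_eq, not_not] at hw
  obtain ⟨hwp, hwq, hwpq, hrot, hrot_shift, -⟩ := hw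
  rw [← hwpq, ← hwp, ← hwq, hrot, hrot_shift, add_add_add_comm]

lemma exists_continuousLinearMap_selfCorrectionError_le [NormedSpace ℝ F] (hf : Measurable f)
    (hdiff : differenceError f ≤ 1 / 100) (hrot : rotatedDifferenceError f ≤ 1 / 100) :
    ∃ L : E →L[ℝ] F, ∀ p, ‖p‖ ≤ 1 / 50 → selfCorrectionError f p (L p) ≤ 1 / 10 := by
  choose h herr using exists_selfCorrectionError_le hf
  obtain ⟨M, hM⟩ := exists_norm_le_of_selfCorrectionError_le hf
  have hsqrt : √2 ≤ 2 := Real.sqrt_le_iff.2 ⟨by norm_num, by norm_num⟩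
  have hsmall (p : E) (hp : ‖p‖ ≤ 1 / 50) : selfCorrectionError f p (h p) ≤ 1 / 10 := by
    linarith [herr p]
  have hadd (p q : E) (hp : ‖p‖ ≤ 1 / 50) (hq : ‖q‖ ≤ 1 / 50) (hpq : ‖p + q‖ ≤ 1 / 50) :
      h (p + q) = h p + h q := by
    refine eq_add_of_selfCorrectionError_lt (p := p) (q := q) hf ?_
    have hpq' : √2 * (‖p‖ + ‖q‖) ≤ 2 * (1 / 50 + 1 / 50) := by gcongr
    linarith [hsmall p hp, hsmall q hq, hsmall _ hpq]
  have hbound (p : E) (hp : ‖p‖ ≤ 1 / 50) : ‖h p‖ ≤ M := hM p _ (by linarith [hsmall p hp])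
  obtain ⟨L, hL⟩ := exists_continuousLinearMap_eqOn_closedBall (by norm_num) hadd hbound
  exact ⟨L, fun p hp => hL p hp ▸ hsmall p hp⟩

end SelfCorrection

namespace QueryAlg

variable {n : ℕ} {α β : Type} {f : RealSpace n → ℝ} {D : Measure (RealSpace n)}

lemma bind_eq (T : QueryAlg n α) (k : α → QueryAlg n β) : T >>= k = T.andThen k := rfl

lemma pure_eq (a : α) : (pure a : QueryAlg n α) = output a := rfl

/-- Run `T` and, if it accepts, let `T'` decide. -/
def andTest (T T' : QueryAlg n Bool) : QueryAlg n Bool :=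
  T.andThen fun b => if b then T' else output false

lemma repeatTest_succ (T : QueryAlg n Bool) (k : ℕ) :
    repeatTest T (k + 1) = T.andTest (repeatTest T k) := rfl

lemma singleDirectionTester_eq_andTest (N M : ℕ) : singleDirectionTester n N M =
    (repeatTest additivityRound N).andTest (repeatTest correctionRound M) := rfl

-- The integrals in `prob` are lower integrals, which are superadditive for all functions.
lemma prob_mul_add_prob_mul_le_prob_andThen (T : QueryAlg n Bool) (k : Bool → QueryAlg n β)
    (b : β) :
    T.prob f D true * (k true).prob f D b + T.prob f D false * (k false).prob f D b
      ≤ (T.andThen k).prob f D b := by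
  have hlintegral (μ : Measure (RealSpace n)) (u v : RealSpace n → ℝ≥0∞) (r s : ℝ≥0∞) :
      (∫⁻ x, u x ∂μ) * r + (∫⁻ x, v x ∂μ) * s ≤ ∫⁻ x, (u x * r + v x * s) ∂μ :=
    (add_le_add (lintegral_mul_const_le r u) (lintegral_mul_const_le s v)).trans
      (le_lintegral_add _ _)
  induction T with
  | output a => cases a <;> simp [andThen, prob]
  | query x _ ih => exact ih (f x)
  | sample next ih => exact (hlintegral _ _ _ _ _).trans (lintegral_mono ih)
  | gaussian next ih => exact (hlintegral _ _ _ _ _).trans (lintegral_mono ih)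

lemma prob_true_mul_prob_true_le_andTest (T T' : QueryAlg n Bool) :
    T.prob f D true * T'.prob f D true ≤ (T.andTest T').prob f D true := by
  simpa [prob, andTest] using prob_mul_add_prob_mul_le_prob_andThen (f := f) (D := D) T
    (fun b => if b then T' else output false) true

lemma prob_false_add_prob_true_mul_prob_false_le_andTest (T T' : QueryAlg n Bool) :
    T.prob f D false + T.prob f D true * T'.prob f D false ≤ (T.andTest T').prob f D false := by
  simpa [prob, andTest, add_comm] using prob_mul_add_prob_mul_le_prob_andThen (f := f) (D := D) T
    (fun b => if b then T' else output false) false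

lemma prob_le_one [IsProbabilityMeasure D] (T : QueryAlg n α) (a : α) : T.prob f D a ≤ 1 := by
  induction T with
  | output a' => rw [prob]; split_ifs <;> simp
  | query x _ ih => exact ih (f x)
  | sample next ih => exact (lintegral_mono ih).trans (by simp)
  | gaussian next ih => exact (lintegral_mono ih).trans (by simp)

lemma prob_true_andTest_eq_one [IsProbabilityMeasure D] {T T' : QueryAlg n Bool}
    (hT : T.prob f D true = 1) (hT' : T'.prob f D true = 1) :
    (T.andTest T').prob f D true = 1 :=
  (prob_le_one _ _).antisymm <| by
    simpa only [hT, hT', mul_one] using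
      prob_true_mul_prob_true_le_andTest (f := f) (D := D) T T'

lemma prob_true_repeatTest_eq_one [IsProbabilityMeasure D] {T : QueryAlg n Bool}
    (hT : T.prob f D true = 1) (k : ℕ) : (repeatTest T k).prob f D true = 1 := by
  induction k with
  | zero => simp [repeatTest, pure_eq, prob]
  | succ k ih => exact prob_true_andTest_eq_one hT ih

lemma prob_false_le_prob_false_andTest_left (T T' : QueryAlg n Bool) :
    T.prob f D false ≤ (T.andTest T').prob f D false :=
  le_self_add.trans (prob_false_add_prob_true_mul_prob_false_le_andTest T T')

lemma prob_false_le_prob_false_andTest_right [IsProbabilityMeasure D] {T : QueryAlg n Bool}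
    (hT : 1 ≤ T.prob f D true + T.prob f D false) (T' : QueryAlg n Bool) :
    T'.prob f D false ≤ (T.andTest T').prob f D false := calc
  T'.prob f D false = 1 * T'.prob f D false := (one_mul _).symm
  _ ≤ (T.prob f D true + T.prob f D false) * T'.prob f D false := by gcongr
  _ = T.prob f D false * T'.prob f D false + T.prob f D true * T'.prob f D false := by ring
  _ ≤ T.prob f D false * 1 + T.prob f D true * T'.prob f D false := by
    gcongr
    exact prob_le_one T' false
  _ ≤ (T.andTest T').prob f D false := by
    rw [mul_one]
    exact prob_false_add_prob_true_mul_prob_false_le_andTest T T'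

lemma one_le_prob_true_add_prob_false_andTest {T T' : QueryAlg n Bool}
    (hT : 1 ≤ T.prob f D true + T.prob f D false)
    (hT' : 1 ≤ T'.prob f D true + T'.prob f D false) :
    1 ≤ (T.andTest T').prob f D true + (T.andTest T').prob f D false := calc
  1 ≤ T.prob f D true * 1 + T.prob f D false := by rwa [mul_one]
  _ ≤ T.prob f D true * (T'.prob f D true + T'.prob f D false) + T.prob f D false := by gcongr
  _ = T.prob f D true * T'.prob f D true
        + (T.prob f D false + T.prob f D true * T'.prob f D false) := by ring
  _ ≤ _ := add_le_add (prob_true_mul_prob_true_le_andTest T T')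
    (prob_false_add_prob_true_mul_prob_false_le_andTest T T')

lemma one_le_prob_true_add_prob_false_repeatTest {T : QueryAlg n Bool}
    (hT : 1 ≤ T.prob f D true + T.prob f D false) (k : ℕ) :
    1 ≤ (repeatTest T k).prob f D true + (repeatTest T k).prob f D false := by
  induction k with
  | zero => simp [repeatTest, pure_eq, prob]
  | succ k ih => exact one_le_prob_true_add_prob_false_andTest hT ih

lemma one_sub_one_sub_pow_le_prob_false_repeatTest {T : QueryAlg n Bool}
    (hT : 1 ≤ T.prob f D true + T.prob f D false) (k : ℕ) :
    1 - (1 - T.prob f D false) ^ k ≤ (repeatTest T k).prob f D false := by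
  rw [tsub_le_iff_right]
  induction k with
  | zero => simp
  | succ k ih => calc
      1 ≤ T.prob f D false + (1 - T.prob f D false) * 1 := by
          rw [mul_one]
          exact le_add_tsub
      _ ≤ T.prob f D false + (1 - T.prob f D false) *
            ((repeatTest T k).prob f D false + (1 - T.prob f D false) ^ k) := by gcongr
      _ = T.prob f D false + (1 - T.prob f D false) * (repeatTest T k).prob f D false
            + (1 - T.prob f D false) ^ (k + 1) := by ring
      _ ≤ T.prob f D false + T.prob f D true * (repeatTest T k).prob f D false
            + (1 - T.prob f D false) ^ (k + 1) := by
          gcongr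
          exact tsub_le_iff_right.2 hT
      _ ≤ (repeatTest T (k + 1)).prob f D false + (1 - T.prob f D false) ^ (k + 1) := by
          rw [repeatTest_succ]
          gcongr
          exact prob_false_add_prob_true_mul_prob_false_le_andTest _ _

lemma two_thirds_le_prob_false_repeatTest [IsProbabilityMeasure D] {T : QueryAlg n Bool}
    (hT : 1 ≤ T.prob f D true + T.prob f D false) {t : ℝ} (ht : 0 ≤ t)
    (htT : ENNReal.ofReal t ≤ T.prob f D false) {k : ℕ} (hk : 2 ≤ k * t) :
    2 / 3 ≤ (repeatTest T k).prob f D false := by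
  have ht_le : 0 ≤ 1 - t := sub_nonneg.2 (ENNReal.ofReal_le_one.1 (htT.trans (prob_le_one T false)))
  have hpow : (1 - t) ^ k ≤ 1 / 3 := calc
    (1 - t) ^ k ≤ Real.exp (-t) ^ k := pow_le_pow_left₀ ht_le (Real.one_sub_le_exp_neg t) k
    _ = Real.exp (-(k * t)) := by rw [← Real.exp_nat_mul, mul_neg]
    _ ≤ Real.exp (-2) := Real.exp_le_exp.2 (neg_le_neg hk)
    _ ≤ 1 / 3 := by
      rw [Real.exp_neg, ← one_div]
      exact one_div_le_one_div_of_le (by norm_num) (by linarith [Real.add_one_le_exp 2])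
  calc (2 / 3 : ℝ≥0∞) = ENNReal.ofReal (1 - 1 / 3) := by
        rw [show (1 - 1 / 3 : ℝ) = 2 / 3 by norm_num, ENNReal.ofReal_div_of_pos (by norm_num)]
        norm_num
    _ ≤ ENNReal.ofReal (1 - (1 - t) ^ k) := by gcongr
    _ = 1 - (1 - ENNReal.ofReal t) ^ k := by
        rw [ENNReal.ofReal_sub _ (pow_nonneg ht_le k), ENNReal.ofReal_pow ht_le,
          ENNReal.ofReal_sub _ ht, ENNReal.ofReal_one]
    _ ≤ 1 - (1 - T.prob f D false) ^ k := by gcongr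
    _ ≤ _ := one_sub_one_sub_pow_le_prob_false_repeatTest hT k

lemma queryComplexity_query_le {x : RealSpace n} {next : ℝ → QueryAlg n α} {c : ℕ}
    (h : ∀ y, (next y).queryComplexity ≤ c) : (query x next).queryComplexity ≤ (c + 1 : ℕ) := by
  rw [queryComplexity, Nat.cast_add, Nat.cast_one, add_comm]
  gcongr
  exact iSup_le h

lemma queryComplexity_andThen_le {T : QueryAlg n α} {k : α → QueryAlg n β} {c : ℕ∞}
    (hk : ∀ a, (k a).queryComplexity ≤ c) :
    (T.andThen k).queryComplexity ≤ T.queryComplexity + c := by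
  induction T with
  | output a => simpa [andThen, queryComplexity] using hk a
  | query x next ih =>
    simp only [andThen, queryComplexity, add_assoc, ENat.iSup_add]
    gcongr
    exact ih _
  | sample next ih =>
    simp only [andThen, queryComplexity, ENat.iSup_add]
    exact iSup_mono ih
  | gaussian next ih =>
    simp only [andThen, queryComplexity, ENat.iSup_add]
    exact iSup_mono ih

lemma queryComplexity_andTest_le {T T' : QueryAlg n Bool} {c c' : ℕ}
    (hT : T.queryComplexity ≤ c) (hT' : T'.queryComplexity ≤ c') :
    (T.andTest T').queryComplexity ≤ (c + c' : ℕ) := by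
  rw [Nat.cast_add]
  refine (queryComplexity_andThen_le fun b => ?_).trans (add_le_add_left hT _)
  cases b
  · simp [queryComplexity]
  · exact hT'

lemma queryComplexity_repeatTest_le {T : QueryAlg n Bool} {c : ℕ}
    (hT : T.queryComplexity ≤ c) (k : ℕ) : (repeatTest T k).queryComplexity ≤ (k * c : ℕ) := by
  induction k with
  | zero => simp [repeatTest, pure_eq, queryComplexity]
  | succ k ih => simpa only [Nat.succ_mul, add_comm, repeatTest_succ] using
      queryComplexity_andTest_le hT ih

open Classical in
lemma additivityRound_eq : additivityRound (n := n) =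
    gaussian fun x => gaussian fun y => gaussian fun z => query (-x) fun fnx => query x fun fx =>
      if fnx ≠ -fx then output false else query (x - y) fun fxy => query y fun fy =>
        if fxy ≠ fx - fy then output false else query ((√2)⁻¹ • (x - y)) fun a =>
          query ((√2)⁻¹ • (x - z)) fun b => query ((√2)⁻¹ • (z - y)) fun c =>
            if a ≠ b + c then output false else output true := by
  simp only [additivityRound, bind_eq, drawGaussian, ask, andThen, pure_eq]

open Classical in
lemma correctionRound_eq : correctionRound (n := n) =
    sample fun p => query p fun w => gaussian fun x =>
      query ((contractionFactor p)⁻¹ • p - x) fun u => query x fun v =>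
        if w ≠ contractionFactor p * (u + v) then output false else output true := rfl

lemma queryComplexity_additivityRound_le :
    (additivityRound (n := n)).queryComplexity ≤ (7 : ℕ) := by
  rw [additivityRound_eq]
  refine iSup_le fun x => iSup_le fun y => iSup_le fun z =>
    queryComplexity_query_le fun _ => queryComplexity_query_le fun _ => ?_
  split_ifs
  · simp [queryComplexity]
  refine queryComplexity_query_le fun _ => queryComplexity_query_le fun _ => ?_
  split_ifs
  · simp [queryComplexity]
  refine queryComplexity_query_le fun _ => queryComplexity_query_le fun _ =>
    queryComplexity_query_le (c := 0) fun _ => ?_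
  split_ifs <;> simp [queryComplexity]

lemma queryComplexity_correctionRound_le :
    (correctionRound (n := n)).queryComplexity ≤ (3 : ℕ) := by
  rw [correctionRound_eq]
  refine iSup_le fun p => queryComplexity_query_le fun _ => iSup_le fun x =>
    queryComplexity_query_le fun _ => queryComplexity_query_le (c := 0) fun _ => ?_
  split_ifs <;> simp [queryComplexity]

lemma queryComplexity_singleDirectionTester_le (N M : ℕ) :
    (singleDirectionTester n N M).queryComplexity ≤ (N * 7 + M * 3 : ℕ) := by
  rw [singleDirectionTester_eq_andTest]
  exact queryComplexity_andTest_le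
    (queryComplexity_repeatTest_le queryComplexity_additivityRound_le N)
    (queryComplexity_repeatTest_le queryComplexity_correctionRound_le M)

end QueryAlg

/-- The triples `(x, y, z)` of Gaussian vectors for which a round of the additivity subroutine
accepts `f`. -/
def additivityAccepts {n : ℕ} (f : RealSpace n → ℝ) :
    Set (RealSpace n × RealSpace n × RealSpace n) :=
  {w | f (-w.1) = -f w.1 ∧ f (w.1 - w.2.1) = f w.1 - f w.2.1 ∧
    f ((√2)⁻¹ • (w.1 - w.2.1)) = f ((√2)⁻¹ • (w.1 - w.2.2)) + f ((√2)⁻¹ • (w.2.2 - w.2.1))}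

/-- The pairs `(p, x)` of a sample and a Gaussian direction for which a comparison round
accepts `f`. -/
def correctionAccepts {n : ℕ} (f : RealSpace n → ℝ) : Set (RealSpace n × RealSpace n) :=
  {w | f w.1 = contractionFactor w.1 * (f ((contractionFactor w.1)⁻¹ • w.1 - w.2) + f w.2)}

open Classical in
lemma measurableSet_decide_mem_eq {X : Type*} [MeasurableSpace X] {S : Set X}
    (hS : MeasurableSet S) (b : Bool) : MeasurableSet {w | decide (w ∈ S) = b} := by
  cases b
  · simp only [decide_eq_false_iff_not]
    exact hS.compl
  · simp only [decide_eq_true_eq]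
    exact hS

section Rounds

open QueryAlg

variable {n : ℕ} {f : RealSpace n → ℝ} {D : Measure (RealSpace n)}

lemma measurableSet_additivityAccepts (hf : Measurable f) : MeasurableSet (additivityAccepts f) :=
  (measurableSet_eq_fun (by fun_prop) (by fun_prop)).inter
    ((measurableSet_eq_fun (by fun_prop) (by fun_prop)).inter
      (measurableSet_eq_fun (by fun_prop) (by fun_prop)))

lemma measurable_contractionFactor : Measurable (contractionFactor (n := n)) :=
  Measurable.ite (measurableSet_le (by fun_prop) (by fun_prop)) (by fun_prop) (by fun_prop)

lemma measurableSet_correctionAccepts (hf : Measurable f) :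
    MeasurableSet (correctionAccepts f) := by
  have := measurable_contractionFactor (n := n)
  exact measurableSet_eq_fun (by fun_prop) (by fun_prop)

lemma contractionFactor_pos (p : RealSpace n) : 0 < contractionFactor p := by
  rw [contractionFactor]
  split_ifs with h
  · exact one_pos
  · linarith

lemma norm_inv_contractionFactor_smul_le (p : RealSpace n) :
    ‖(contractionFactor p)⁻¹ • p‖ ≤ 1 / 50 := by
  rw [norm_smul, norm_inv, Real.norm_of_nonneg (contractionFactor_pos p).le,
    inv_mul_le_iff₀ (contractionFactor_pos p), contractionFactor]
  split_ifs <;> linarith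

open Classical in
lemma prob_additivityRound (hf : Measurable f) (b : Bool) :
    additivityRound.prob f D b = ((stdGaussian (RealSpace n)).prod
      ((stdGaussian (RealSpace n)).prod (stdGaussian (RealSpace n))))
        {w | decide (w ∈ additivityAccepts f) = b} := by
  have hS := measurableSet_decide_mem_eq (measurableSet_additivityAccepts hf) b
  rw [additivityRound_eq, Measure.prod_apply hS]
  refine lintegral_congr fun x => ?_
  rw [Measure.prod_apply (measurable_prodMk_left hS)]
  refine lintegral_congr fun y => ?_
  rw [← lintegral_indicator_one (measurable_prodMk_left (measurable_prodMk_left hS))]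
  refine lintegral_congr fun z => ?_
  simp only [prob, Set.indicator_apply, Set.mem_preimage, Set.mem_ofPred_eq, additivityAccepts]
  by_cases hneg : f (-x) = -f x <;> by_cases hsub : f (x - y) = f x - f y <;>
    by_cases hrot : f ((√2)⁻¹ • (x - y)) =
      f ((√2)⁻¹ • (x - z)) + f ((√2)⁻¹ • (z - y)) <;>
    cases b <;> simp [prob, hneg, hsub, hrot]

open Classical in
lemma prob_correctionRound (hf : Measurable f) (b : Bool) :
    correctionRound.prob f D b = (D.prod (stdGaussian (RealSpace n)))
      {w | decide (w ∈ correctionAccepts f) = b} := by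
  have hS := measurableSet_decide_mem_eq (measurableSet_correctionAccepts hf) b
  rw [correctionRound_eq, Measure.prod_apply hS]
  refine lintegral_congr fun p => ?_
  simp only [prob]
  rw [← lintegral_indicator_one (measurable_prodMk_left hS)]
  refine lintegral_congr fun x => ?_
  simp only [Set.indicator_apply, Set.mem_preimage, Set.mem_ofPred_eq, correctionAccepts]
  split_ifs <;> cases b <;> simp_all [prob]

lemma prob_false_additivityRound (hf : Measurable f) :
    additivityRound.prob f D false = ((stdGaussian (RealSpace n)).prod
      ((stdGaussian (RealSpace n)).prod (stdGaussian (RealSpace n)))) (additivityAccepts f)ᶜ := by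
  rw [prob_additivityRound hf]
  simp [Set.compl_def]

lemma prob_false_correctionRound (hf : Measurable f) :
    correctionRound.prob f D false =
      (D.prod (stdGaussian (RealSpace n))) (correctionAccepts f)ᶜ := by
  rw [prob_correctionRound hf]
  simp [Set.compl_def]

lemma prob_true_add_prob_false_additivityRound (hf : Measurable f) :
    additivityRound.prob f D true + additivityRound.prob f D false = 1 := by
  rw [prob_false_additivityRound hf, prob_additivityRound hf]
  simpa using prob_add_prob_compl (measurableSet_additivityAccepts hf)

lemma prob_true_add_prob_false_correctionRound [IsProbabilityMeasure D] (hf : Measurable f) :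
    correctionRound.prob f D true + correctionRound.prob f D false = 1 := by
  rw [prob_false_correctionRound hf, prob_correctionRound hf]
  simpa using prob_add_prob_compl (measurableSet_correctionAccepts hf)

lemma prob_true_additivityRound_continuousLinearMap (L : RealSpace n →L[ℝ] ℝ) :
    additivityRound.prob L D true = 1 := by
  simp [additivityRound_eq, prob, ← mul_add]

lemma prob_true_correctionRound_continuousLinearMap [IsProbabilityMeasure D]
    (L : RealSpace n →L[ℝ] ℝ) : correctionRound.prob L D true = 1 := by
  simp [correctionRound_eq, prob, mul_inv_cancel_left₀ (contractionFactor_pos _).ne']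

lemma prob_true_singleDirectionTester_continuousLinearMap [IsProbabilityMeasure D]
    (L : RealSpace n →L[ℝ] ℝ) (N M : ℕ) : (singleDirectionTester n N M).prob L D true = 1 := by
  rw [singleDirectionTester_eq_andTest]
  exact prob_true_andTest_eq_one
    (prob_true_repeatTest_eq_one (prob_true_additivityRound_continuousLinearMap L) N)
    (prob_true_repeatTest_eq_one (prob_true_correctionRound_continuousLinearMap L) M)

lemma differenceError_le_prob_false_additivityRound (hf : Measurable f) :
    differenceError f ≤ (additivityRound.prob f D false).toReal := by
  have hpair : MeasurePreserving (Prod.map id Prod.fst)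
      ((stdGaussian (RealSpace n)).prod
        ((stdGaussian (RealSpace n)).prod (stdGaussian (RealSpace n))))
      ((stdGaussian (RealSpace n)).prod (stdGaussian (RealSpace n))) :=
    (MeasurePreserving.id _).prod measurePreserving_fst
  have hB : MeasurableSet {w : RealSpace n × RealSpace n | f (w.1 - w.2) ≠ f w.1 - f w.2} :=
    (measurableSet_eq_fun (by fun_prop) (by fun_prop)).compl
  rw [differenceError, ← hpair.measureReal_preimage hB.nullMeasurableSet,
    prob_false_additivityRound hf]
  exact measureReal_mono fun w hw haccept => hw haccept.2.1

lemma rotatedDifferenceError_le_prob_false_additivityRound (hf : Measurable f) :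
    rotatedDifferenceError f ≤ (additivityRound.prob f D false).toReal := by
  rw [rotatedDifferenceError, prob_false_additivityRound hf]
  exact measureReal_mono fun w hw haccept => hw haccept.2.2

lemma ofReal_mul_measure_ne_le_prob_false_correctionRound (hf : Measurable f)
    {L : RealSpace n →L[ℝ] ℝ}
    (hL : ∀ p, ‖p‖ ≤ 1 / 50 → selfCorrectionError f p (L p) ≤ 1 / 10) :
    ENNReal.ofReal (9 / 10) * D {p | f p ≠ L p} ≤ correctionRound.prob f D false := by
  have hreject (p : RealSpace n) (hp : f p ≠ L p) :
      9 / 10 ≤ (stdGaussian (RealSpace n)).real (Prod.mk p ⁻¹' (correctionAccepts f)ᶜ) := by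
    set q := (contractionFactor p)⁻¹ • p
    have hsub : Prod.mk p ⁻¹' correctionAccepts f ⊆ {x | f (q - x) + f x ≠ L q} := by
      intro x (hx : f p = contractionFactor p * (f (q - x) + f x)) hxq
      rw [hxq, map_smul, smul_eq_mul, mul_inv_cancel_left₀ (contractionFactor_pos p).ne'] at hx
      exact hp hx
    rw [Set.preimage_compl,
      probReal_compl_eq_one_sub (measurable_prodMk_left (measurableSet_correctionAccepts hf))]
    linarith [(measureReal_mono hsub).trans (hL q (norm_inv_contractionFactor_smul_le p))]
  have hS := (measurableSet_correctionAccepts hf).compl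
  rw [prob_false_correctionRound hf, Measure.prod_apply hS]
  calc _ ≤ ENNReal.ofReal (9 / 10) * D {p | ENNReal.ofReal (9 / 10) ≤
          stdGaussian (RealSpace n) (Prod.mk p ⁻¹' (correctionAccepts f)ᶜ)} := by
        gcongr with p
        exact fun hp => ENNReal.ofReal_le_of_le_toReal (hreject p hp)
    _ ≤ _ := mul_meas_ge_le_lintegral (measurable_measure_prodMk_left hS) _

end Rounds

section Tester

open QueryAlg

variable {n : ℕ} {f : RealSpace n → ℝ} {T : QueryAlg n Bool} {F F' P : Set (RealSpace n → ℝ)}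
  {ε : ℝ}

lemma mem_linearFunctions_iff : f ∈ linearFunctions n ↔ ∃ L : RealSpace n →L[ℝ] ℝ, ⇑L = f := by
  constructor
  · rintro ⟨c, hc⟩
    refine ⟨∑ i, c i • EuclideanSpace.proj i, funext fun x => ?_⟩
    simp [hc]
  · rintro ⟨L, rfl⟩
    refine ⟨fun i => L (EuclideanSpace.single i 1), fun x => ?_⟩
    conv_lhs => rw [← (EuclideanSpace.basisFun (Fin n) ℝ).sum_repr x]
    simp [mul_comm]

lemma additiveFunctions_eq_linearFunctions : additiveFunctions n = linearFunctions n := by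
  ext f
  rw [mem_linearFunctions_iff]
  constructor
  · rintro ⟨hf, hadd⟩
    set g : RealSpace n →+ ℝ := AddMonoidHom.mk' f fun x y => (hadd x y).symm
    exact ⟨g.toRealLinearMap (Measure.AddMonoidHom.continuous_of_measurable g hf), rfl⟩
  · rintro ⟨L, rfl⟩
    exact ⟨L.continuous.measurable, fun x y => (map_add L x y).symm⟩

lemma HasOneSidedError.mono (hT : HasOneSidedError T F P) (hF : F' ⊆ F) :
    HasOneSidedError T F' P :=
  fun D _ f hf => hT D f (hF hf)

lemma IsDistributionFreeTester.mono (hT : IsDistributionFreeTester T F P ε) (hF : F' ⊆ F) :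
    IsDistributionFreeTester T F' P ε :=
  ⟨fun D _ f hf => hT.complete D f (hF hf), fun D _ f hf => hT.sound D f (hF hf)⟩

lemma hasOneSidedError_singleDirectionTester (F : Set (RealSpace n → ℝ)) (N M : ℕ) :
    HasOneSidedError (singleDirectionTester n N M) F (linearFunctions n) := by
  intro D _ f _ hf
  obtain ⟨L, rfl⟩ := mem_linearFunctions_iff.1 hf
  exact prob_true_singleDirectionTester_continuousLinearMap L N M

lemma prob_false_singleDirectionTester_of_le_distToProperty {D : Measure (RealSpace n)}
    [IsProbabilityMeasure D] (hf : Measurable f) (hε : 0 < ε)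
    (hfar : ENNReal.ofReal ε ≤ distToProperty D f (linearFunctions n)) {N M : ℕ} (hN : 200 ≤ N)
    (hM : 3 / ε ≤ M) : 2 / 3 ≤ (singleDirectionTester n N M).prob f D false := by
  rw [singleDirectionTester_eq_andTest]
  have hround := (prob_true_add_prob_false_additivityRound (D := D) hf).ge
  rcases le_total (additivityRound.prob f D false) (ENNReal.ofReal (1 / 100)) with hrare | hoften
  · have herr := ENNReal.toReal_le_of_le_ofReal (by norm_num) hrare
    obtain ⟨L, hL⟩ := exists_continuousLinearMap_selfCorrectionError_le hf
      ((differenceError_le_prob_false_additivityRound hf).trans herr)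
      ((rotatedDifferenceError_le_prob_false_additivityRound hf).trans herr)
    have hreject : ENNReal.ofReal (9 / 10 * ε) ≤ correctionRound.prob f D false := calc
      _ ≤ ENNReal.ofReal (9 / 10) * D {p | f p ≠ L p} := by
        rw [ENNReal.ofReal_mul (by norm_num)]
        gcongr
        exact hfar.trans (iInf₂_le ⇑L (mem_linearFunctions_iff.2 ⟨L, rfl⟩))
      _ ≤ _ := ofReal_mul_measure_ne_le_prob_false_correctionRound hf hL
    calc 2 / 3 ≤ (repeatTest correctionRound M).prob f D false :=
          two_thirds_le_prob_false_repeatTest (prob_true_add_prob_false_correctionRound hf).ge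
            (by positivity) hreject (by linarith [(div_le_iff₀ hε).1 hM])
      _ ≤ _ := prob_false_le_prob_false_andTest_right
          (one_le_prob_true_add_prob_false_repeatTest hround N) _
  · have hN' : (200 : ℝ) ≤ N := by exact_mod_cast hN
    calc 2 / 3 ≤ (repeatTest additivityRound N).prob f D false :=
          two_thirds_le_prob_false_repeatTest hround (by norm_num) hoften (by linarith)
      _ ≤ _ := prob_false_le_prob_false_andTest_left _ _

lemma isDistributionFreeTester_singleDirectionTester (hε : 0 < ε) {N M : ℕ} (hN : 200 ≤ N)
    (hM : 3 / ε ≤ M) : IsDistributionFreeTester (singleDirectionTester n N M)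
      {f | Measurable f} (linearFunctions n) ε where
  complete D _ f hf hfP := by
    rw [hasOneSidedError_singleDirectionTester _ N M D f hf hfP]
    exact ENNReal.div_le_of_le_mul (by norm_num)
  sound _ _ _ hf hfar := prob_false_singleDirectionTester_of_le_distToProperty hf hε hfar.le hN hM

end Tester

theorem theorem1p3_general :
    ∃ (N : ℕ) (K C : ℝ), ∀ (n : ℕ) (ε : ℝ), 0 < ε → ε < 1 →
      (∃ q : ℕ, (singleDirectionTester n N ⌈K / ε⌉₊).queryComplexity ≤ (q : ℕ∞) ∧
        (q : ℝ) ≤ C / ε) ∧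
      IsDistributionFreeTester (singleDirectionTester n N ⌈K / ε⌉₊)
        {f | Measurable f} (linearFunctions n) ε ∧
      HasOneSidedError (singleDirectionTester n N ⌈K / ε⌉₊)
        {f | Measurable f} (linearFunctions n) := by
  refine ⟨200, 3, 1412, fun n ε hε hε1 =>
    ⟨⟨_, QueryAlg.queryComplexity_singleDirectionTester_le _ _, ?_⟩,
      isDistributionFreeTester_singleDirectionTester hε le_rfl (Nat.le_ceil _),
      hasOneSidedError_singleDirectionTester _ _ _⟩⟩
  have hceil : (⌈3 / ε⌉₊ : ℝ) < 3 / ε + 1 := Nat.ceil_lt_add_one (by positivity)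
  have hinv : 1 ≤ 1 / ε := (one_le_div hε).2 hε1.le
  calc ((200 * 7 + ⌈3 / ε⌉₊ * 3 : ℕ) : ℝ) ≤ 1403 * 1 + 3 * (3 / ε) := by
        push_cast
        linarith
    _ ≤ 1403 * (1 / ε) + 3 * (3 / ε) := by gcongr
    _ = 1412 / ε := by ring

end

/-- There are absolute constants `N`, `K`, `C` such that for all `n` and `ε ∈ (0,1)` the tester with
`N` additivity rounds and `⌈K/ε⌉` comparison rounds, each of which evaluates the self-corrected
function with a single Gaussian direction, makes at most `C/ε` queries and is a distribution-free
tester with one-sided error for additivity of (measurable) functions, and also for linearity of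
continuous functions. -/
theorem theorem1p3 :
    ∃ (N : ℕ) (K C : ℝ), ∀ (n : ℕ) (ε : ℝ), 0 < ε → ε < 1 →
      (∃ q : ℕ, (singleDirectionTester n N ⌈K / ε⌉₊).queryComplexity ≤ (q : ℕ∞) ∧
        (q : ℝ) ≤ C / ε) ∧
      (IsDistributionFreeTester (singleDirectionTester n N ⌈K / ε⌉₊)
          {f | Measurable f} (additiveFunctions n) ε ∧
        HasOneSidedError (singleDirectionTester n N ⌈K / ε⌉₊)
          {f | Measurable f} (additiveFunctions n)) ∧
      (IsDistributionFreeTester (singleDirectionTester n N ⌈K / ε⌉₊)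
          {f | Continuous f} (linearFunctions n) ε ∧
        HasOneSidedError (singleDirectionTester n N ⌈K / ε⌉₊)
          {f | Continuous f} (linearFunctions n)) := by
  obtain ⟨N, K, C, h⟩ := theorem1p3_general
  refine ⟨N, K, C, fun n ε hε hε1 => ?_⟩
  obtain ⟨hqueries, htester, honesided⟩ := h n ε hε hε1
  have hcont : {f : RealSpace n → ℝ | Continuous f} ⊆ {f | Measurable f} :=
    fun _ hf => hf.measurable
  exact ⟨hqueries, additiveFunctions_eq_linearFunctions (n := n) ▸ ⟨htester, honesided⟩,
    htester.mono hcont, honesided.mono hcont⟩
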